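/- **Theorem (Giambelli formula for Schur type quasi-symmetric functions).** Let $\mathbb{N}$ be the set of positive integers and let $t_1,t_2,\ldots$ be variables. A formal power series $p\in\mathbb{Z}[\![t_1,t_2,\ldots]\!]$ is *quasi-symmetric* if it has bounded degree and, for all $n$ and all $g_1,\ldots,g_n\in\mathbb{N}$, the coefficients of $t_{k_1}^{g_1}\cdots t_{k_n}^{g_n}$ and $t_{h_1}^{g_1}\cdots t_{h_n}^{g_n}$ in $p$ agree whenever $k_1<\cdots<k_n$ and $h_1<\cdots<h_n$. For a partition $\lambda$ with Young diagram $D(\lambda)$ and a filling $\gamma=(\gamma_{ij})_{(i,j)\in D(\lambda)}$ with $\gamma_{ij}\in\mathbb{N}$, put $$S_\lambda(\gamma)=\sum_{(m_{ij})\in\mathrm{SSYT}(\lambda)}\ \prod_{(i,j)\in D(\lambda)}t_{m_{ij}}^{\gamma_{ij}}\in\mathbb{Z}[\![t_1,t_2,\ldots]\!],$$ where $\mathrm{SSYT}(\lambda)$ is the set of semistandard Young tableaux of shape $\lambda$ with entries in $\mathbb{N}$ (rows weakly increasing, columns strictly increasing); for $\lambda=\emptyset$ this is $1$. Let $\lambda$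 be a partition, let $t$ be the number of its diagonal cells, and put $p_i=\lambda_i-i+1$ and $q_i=\lambda'_i-i$ for $1\le i\le t$, where $\lambda'$ is the conjugate of $\lambda$, so that $\lambda=(p_1-1,\ldots,p_t-1\,|\,q_1,\ldots,q_t)$ in Frobenius notation. Let $\gamma=(\gamma_{ij})$ be a filling of $D(\lambda)$ with positive integers that is constant along diagonals, i.e. $\gamma_{ij}=\gamma_{kl}$ whenever $j-i=l-k$, and write $c_k=\gamma_{i,i+k}$ for $k\in\mathbb{Z}$. For $1\le i,j\le t$ let $\gamma_{i,j}$ be the filling of the hook $(p_i,1^{q_j})$ whose first row is $c_0,c_1,\ldots,c_{p_i-1}$ and whose first column is $c_0,c_{-1},\ldots,c_{-q_j}$. Then $S_\lambda(\gamma)$ and all $S_{(p_i,1^{q_j})}(\gamma_{i,j})$ are quasi-symmetric, and $$S_\lambda(\gamma)=\det\left[S_{(p_i,1^{q_j})}(\gamma_{i,j})\right]_{1\le i,j\le t}.$$ -/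

import Mathlib

/-! Partitions are Mathlib's `YoungDiagram`s.  As in Mathlib, rows and columns are numbered
from `0`, and the entries of a semistandard tableau are natural numbers starting at `0`; thus the
entry `m` stands for the positive integer `m + 1`, and the variable `X m` for `t_{m+1}`. -/

namespace SchurQSym

/-- Young tableaux of shape `lam` over `A`: fillings of the cells of `lam` with elements of `A`. -/
abbrev Tableau (lam : YoungDiagram) (A : Type*) : Type _ := lam.cells → A

/-- The content `j - i` of the cell `(i, j)`. -/
def content (x : ℕ × ℕ) : ℤ := (x.2 : ℤ) - (x.1 : ℤ)

/-- Tableaux whose entries are constant along every diagonal `j - i = const`. -/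
def diagTableaux (lam : YoungDiagram) (A : Type*) : Set (Tableau lam A) :=
  {T | ∀ x y : lam.cells, content x = content y → T x = T y}

/-- A power series with integer coefficients in variables indexed by `ℕ` is quasi-symmetric if it
has bounded degree and, for every composition `g`, the coefficient of
`t_{k_1}^{g_1} ⋯ t_{k_n}^{g_n}` does not depend on the choice of `k_1 < ⋯ < k_n`. -/
def IsQuasiSymmetric (f : MvPowerSeries ℕ ℤ) : Prop :=
  (∃ N : ℕ, ∀ d : ℕ →₀ ℕ, MvPowerSeries.coeff d f ≠ 0 → d.degree ≤ N) ∧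
  ∀ (n : ℕ) (g : Fin n → ℕ+) (k h : Fin n → ℕ), StrictMono k → StrictMono h →
    MvPowerSeries.coeff (∑ i, Finsupp.single (k i) (g i : ℕ)) f =
      MvPowerSeries.coeff (∑ i, Finsupp.single (h i) (g i : ℕ)) f

/-- The monomial `∏ t_{m_ij}^{γ_ij}` attached to a semistandard tableau `M = (m_ij)`. -/
noncomputable def tableauMonomial {lam : YoungDiagram} (γ : Tableau lam ℕ+)
    (M : SemistandardYoungTableau lam) : MvPowerSeries ℕ ℤ :=
  ∏ x : lam.cells, MvPowerSeries.X (M x.1.1 x.1.2) ^ (γ x : ℕ)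

open scoped MvPowerSeries.WithPiTopology in
/-- The Schur type quasi-symmetric function: the sum of `tableauMonomial γ M` over all
semistandard tableaux `M` of shape `lam`.  The sum is taken in the ring of formal power series,
with the topology of coefficientwise convergence (`ℤ` being discrete); it always converges, see
`hasSum_schur`. -/
noncomputable def schur (lam : YoungDiagram) (γ : Tableau lam ℕ+) : MvPowerSeries ℕ ℤ :=
  ∑' M : SemistandardYoungTableau lam, tableauMonomial γ M

/-- The number `t` of diagonal cells of `lam`. -/
def diagLen (lam : YoungDiagram) : ℕ := (lam.cells.filter fun x => x.1 = x.2).card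

/-- The Frobenius arm length `p_i - 1 = lam_i - i` (with `i` counted from `1`). -/
def arm (lam : YoungDiagram) (i : ℕ) : ℕ := lam.rowLen i - (i + 1)

/-- The Frobenius leg length `q_i = lam'_i - i` (with `i` counted from `1`). -/
def leg (lam : YoungDiagram) (i : ℕ) : ℕ := lam.colLen i - (i + 1)

/-- The hook `(a + 1, 1^b)`, that is, `(a | b)` in Frobenius notation. -/
def hook (a b : ℕ) : YoungDiagram :=
  YoungDiagram.ofRowLens ((a + 1) :: List.replicate b 1) (by
    rw [List.sortedGE_iff_pairwise, List.pairwise_cons]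
    refine ⟨fun x hx => ?_, ?_⟩
    · rw [List.eq_of_mem_replicate hx]; omega
    · rw [List.pairwise_replicate]; simp)

/-- The tableau of shape `(a + 1, 1^b)` with first row `c_0, c_1, …, c_a` and first column
`c_0, c_{-1}, …, c_{-b}`. -/
def hookTableau {A : Type*} (c : ℤ → A) (a b : ℕ) : Tableau (hook a b) A := fun x => c (content x)

/-! Sanity checks for the definitions above. -/

theorem mem_hook {a b i j : ℕ} : (i, j) ∈ hook a b ↔ (i = 0 ∧ j ≤ a) ∨ (j = 0 ∧ i ≤ b) := by
  rw [hook, YoungDiagram.mem_ofRowLens]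
  rcases i with _ | i
  · simp; omega
  · simp; omega

theorem lt_diagLen_iff {lam : YoungDiagram} {i : ℕ} : i < diagLen lam ↔ (i, i) ∈ lam := by
  have hle : ∀ {i j : ℕ}, i ≤ j → (j, j) ∈ lam → (i, i) ∈ lam := fun h hj =>
    lam.up_left_mem h h hj
  have hex : ∃ n, (n, n) ∉ lam := by
    by_contra! hh
    have := lam.mem_iff_lt_rowLen.1 (lam.up_left_mem (Nat.zero_le _) le_rfl (hh (lam.rowLen 0)))
    omega
  classical
  have hfind : ∀ j, (j, j) ∈ lam ↔ j < Nat.find hex := by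
    intro j
    rw [Nat.lt_find_iff]
    exact ⟨fun h m hm => not_not.2 (hle hm h), fun h => not_not.1 (h j le_rfl)⟩
  have : diagLen lam = Nat.find hex := by
    rw [diagLen, ← Finset.card_range (Nat.find hex)]
    symm
    refine Finset.card_bij (fun j _ => (j, j)) ?_ ?_ ?_
    · intro j hj
      exact (hfind j).2 (Finset.mem_range.1 hj) |> fun h => by simpa using h
    · intro j _ j' _ h
      exact (Prod.ext_iff.1 h).1
    · rintro ⟨x, y⟩ h
      simp only [Finset.mem_filter, YoungDiagram.mem_cells] at h
      obtain ⟨h, rfl⟩ := h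
      exact ⟨x, Finset.mem_range.2 ((hfind x).1 h), rfl⟩
  rw [this, hfind]

theorem arm_add {lam : YoungDiagram} {i : ℕ} (h : i < diagLen lam) :
    arm lam i + (i + 1) = lam.rowLen i := by
  have := YoungDiagram.mem_iff_lt_rowLen.1 (lt_diagLen_iff.1 h)
  unfold arm; omega

theorem leg_add {lam : YoungDiagram} {i : ℕ} (h : i < diagLen lam) :
    leg lam i + (i + 1) = lam.colLen i := by
  have := YoungDiagram.mem_iff_lt_colLen.1 (lt_diagLen_iff.1 h)
  unfold leg; omega

theorem tableauMonomial_eq {lam : YoungDiagram} (γ : Tableau lam ℕ+)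
    (M : SemistandardYoungTableau lam) :
    tableauMonomial γ M = MvPowerSeries.monomial
      (∑ x : lam.cells, Finsupp.single (M x.1.1 x.1.2) (γ x : ℕ)) 1 := by
  have h : ∀ s : Finset lam.cells,
      ∏ x ∈ s, (MvPowerSeries.X (M x.1.1 x.1.2) : MvPowerSeries ℕ ℤ) ^ (γ x : ℕ) =
        MvPowerSeries.monomial (∑ x ∈ s, Finsupp.single (M x.1.1 x.1.2) (γ x : ℕ)) 1 := by
    classical
    intro s
    induction s using Finset.induction_on with
    | empty => simp [MvPowerSeries.monomial_zero_one]
    | insert x s hx ih =>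
      rw [Finset.prod_insert hx, Finset.sum_insert hx, ih, MvPowerSeries.X_pow_eq,
        MvPowerSeries.monomial_mul_monomial, one_mul]
  exact h Finset.univ

theorem finite_weight {lam : YoungDiagram} (γ : Tableau lam ℕ+) (d : ℕ →₀ ℕ) :
    {M : SemistandardYoungTableau lam |
      d = ∑ x : lam.cells, Finsupp.single (M x.1.1 x.1.2) (γ x : ℕ)}.Finite := by
  refine Set.Finite.of_finite_image (f := fun M (x : lam.cells) => M x.1.1 x.1.2) ?_ ?_
  · refine (Set.Finite.pi (fun _ : lam.cells => d.support.finite_toSet)).subset ?_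
    rintro _ ⟨M, hM, rfl⟩ x -
    have hM' : d = _ := hM
    rw [Finset.mem_coe, Finsupp.mem_support_iff, hM', Finsupp.finsetSum_apply]
    intro h0
    have := Finset.sum_eq_zero_iff.1 h0 x (Finset.mem_univ x)
    simp at this
  · intro M _ M' _ h
    ext i j
    by_cases hij : (i, j) ∈ lam
    · exact congrFun h ⟨(i, j), hij⟩
    · rw [M.zeros hij, M'.zeros hij]

open scoped MvPowerSeries.WithPiTopology in
theorem hasSum_schur (lam : YoungDiagram) (γ : Tableau lam ℕ+) :
    HasSum (fun M : SemistandardYoungTableau lam => tableauMonomial γ M) (schur lam γ) := by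
  refine Summable.hasSum ?_
  rw [MvPowerSeries.WithPiTopology.summable_iff_summable_coeff]
  intro d
  refine summable_of_hasFiniteSupport ((finite_weight γ d).subset ?_)
  intro M hM
  rw [Function.mem_support, tableauMonomial_eq, MvPowerSeries.coeff_monomial] at hM
  by_contra hne
  exact hM (if_neg hne)

end SchurQSym

namespace SchurQSym

/-! ### Semistandard tableaux with bounded entries -/

/-! Bound the entries by `N` and give an entry `m` in a cell of content `k` an arbitrary weight `z k
m`; constancy along diagonals makes this cover the theorem. Removing the entries `N` from a tableau
removes a horizontal strip. This matches the expansion of a determinant by multilinearity in its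
rows, and induction on `N` gives a dual Jacobi–Trudi formula (`boundedSum_eq_det`) in which column
`j` contributes the row with index `p = j - lam.colLen j` of one fixed array.

Multiplying on the right by the inverse of the unitriangular block `0 ≤ p < n` turns its rows into
unit vectors without changing determinants (`exists_normalized_columnVector`). Columns without a
diagonal cell have `p ≥ 0`, so only a minor of size `diagLen lam` survives, up to the sign of a
permutation whose inversions are counted by the arm lengths (`det_eq_det_frobenius`). The same
normalised array serves every hook involved, where the minor has size one; hence the entries of the
minor are the hook sums (`boundedSum_giambelli`). Letting `N` grow gives the identity of power
series.

Quasi-symmetry is independent of this: coefficients count tableaux, and relabelling entries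
monotonically preserves the counts. -/

theorem finite_bounded (lam : YoungDiagram) (N : ℕ) :
    {M : SemistandardYoungTableau lam | ∀ x ∈ lam.cells, M x.1 x.2 < N}.Finite := by
  refine Set.Finite.of_finite_image (f := fun M (x : lam.cells) => M x.1.1 x.1.2) ?_ ?_
  · refine (Set.Finite.pi (fun _ : lam.cells => Set.finite_Iio N)).subset ?_
    rintro _ ⟨M, hM, rfl⟩ x -
    exact hM x.1 x.2
  · intro M _ M' _ h
    ext i j
    by_cases hij : (i, j) ∈ lam
    · exact congrFun h ⟨(i, j), hij⟩
    · rw [M.zeros hij, M'.zeros hij]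

/-- The semistandard tableaux of shape `lam` with entries less than `N`. -/
noncomputable def boundedTableaux (lam : YoungDiagram) (N : ℕ) :
    Finset (SemistandardYoungTableau lam) := (finite_bounded lam N).toFinset

theorem mem_boundedTableaux {lam : YoungDiagram} {N : ℕ} {M : SemistandardYoungTableau lam} :
    M ∈ boundedTableaux lam N ↔ ∀ i j, (i, j) ∈ lam → M i j < N := by
  simp [boundedTableaux]

/-- The weight `∏ z(c(x), M(x))` of a tableau, where `c(x)` is the content of the cell `x`. -/
def tableauWeight {R : Type*} [CommRing R] (z : ℤ → ℕ → R) {lam : YoungDiagram}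
    (M : SemistandardYoungTableau lam) : R := ∏ x ∈ lam.cells, z (content x) (M x.1 x.2)

/-- The generating function of the semistandard tableaux of shape `lam` with entries less
than `N`. -/
noncomputable def boundedSum {R : Type*} [CommRing R] (z : ℤ → ℕ → R) (lam : YoungDiagram)
    (N : ℕ) : R := ∑ M ∈ boundedTableaux lam N, tableauWeight z M

/-- The columns of `M` whose last entry is `N`. -/
def markedColumns {lam : YoungDiagram} (n N : ℕ) (M : SemistandardYoungTableau lam) :
    Finset (Fin n) :=
  Finset.univ.filter fun j => 0 < lam.colLen j ∧ M (lam.colLen j - 1) j = N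

theorem mem_markedColumns {lam : YoungDiagram} {n N : ℕ} {M : SemistandardYoungTableau lam}
    {j : Fin n} : j ∈ markedColumns n N M ↔ 0 < lam.colLen j ∧ M (lam.colLen j - 1) j = N := by
  simp [markedColumns]

/-- The condition on a set `s` of columns that the last cells of these columns form a horizontal
strip whose removal leaves a Young diagram. -/
def IsRemovable (lam : YoungDiagram) {n : ℕ} (s : Finset (Fin n)) : Prop :=
  (∀ j ∈ s, 0 < lam.colLen j) ∧
    ∀ j ∈ s, ∀ k : Fin n, (k : ℕ) = j + 1 → lam.colLen k = lam.colLen j → k ∈ s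

theorem IsRemovable.mem_of_le {lam : YoungDiagram} {n : ℕ} {s : Finset (Fin n)}
    (hs : IsRemovable lam s) {j k : Fin n} (hj : j ∈ s) (hjk : j ≤ k)
    (h : lam.colLen k = lam.colLen j) : k ∈ s := by
  obtain ⟨k, hk⟩ := k
  obtain ⟨d, rfl⟩ : ∃ d, k = j + d := ⟨k - j, by have : (j : ℕ) ≤ k := hjk; omega⟩
  clear hjk
  induction d with
  | zero => exact hj
  | succ d ih =>
    have hd : (j : ℕ) + d < n := by omega
    have h1 := lam.colLen_anti j (j + d) (by omega)
    have h2 := lam.colLen_anti (j + d) (j + (d + 1)) (by omega)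
    simp only at h
    exact hs.2 _ (ih hd (by simp only; omega)) _ rfl (by simp only; omega)

/-- The Young diagram left after removing the last cells of the columns in `s`. -/
def removeStrip (lam : YoungDiagram) {n : ℕ} (hn : lam.rowLen 0 ≤ n) (s : Finset (Fin n))
    (hs : IsRemovable lam s) : YoungDiagram where
  cells := lam.cells.filter fun x => ∀ j ∈ s, (j : ℕ) = x.2 → x.1 + 1 < lam.colLen x.2
  isLowerSet := by
    rintro ⟨i, j⟩ ⟨i', j'⟩ ⟨hi, hj⟩ h
    simp only [Finset.coe_filter, Set.mem_ofPred_eq, YoungDiagram.mem_cells] at h hi hj ⊢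
    refine ⟨lam.up_left_mem hi hj h.1, ?_⟩
    rintro k hk rfl
    by_contra hlt
    have hjn : j < n := by
      have := YoungDiagram.mem_iff_lt_rowLen.1 (lam.up_left_mem (Nat.zero_le _) le_rfl h.1)
      omega
    -- If the cell in column `k` were removed, columns `k` and `j` would have equal length and the
    -- kept cell would be the last of column `j`, which removability puts in `s`.
    have h1 := lam.colLen_anti k j hj
    have h2 := YoungDiagram.mem_iff_lt_colLen.1 h.1
    have h3 := h.2 ⟨j, hjn⟩ (hs.mem_of_le hk hj (by simp only; omega)) rfl
    omega

section Strip

variable {lam : YoungDiagram} {n : ℕ} {hn : lam.rowLen 0 ≤ n} {s : Finset (Fin n)}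
  {hs : IsRemovable lam s}

theorem mem_removeStrip {i j : ℕ} : (i, j) ∈ removeStrip lam hn s hs ↔
    (i, j) ∈ lam ∧ ∀ k ∈ s, (k : ℕ) = j → i + 1 < lam.colLen j := by
  rw [← YoungDiagram.mem_cells]
  simp [removeStrip]

theorem removeStrip_le : removeStrip lam hn s hs ≤ lam := fun _ hx => (mem_removeStrip.1 hx).1

theorem colLen_removeStrip (j : Fin n) :
    (removeStrip lam hn s hs).colLen j = lam.colLen j - if j ∈ s then 1 else 0 := by
  refine eq_of_forall_lt_iff fun i => ?_
  rw [← YoungDiagram.mem_iff_lt_colLen, mem_removeStrip, YoungDiagram.mem_iff_lt_colLen]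
  split_ifs with hj
  · constructor
    · rintro ⟨_, h2⟩
      have := h2 j hj rfl
      omega
    · exact fun h => ⟨by omega, fun _ _ _ => by omega⟩
  · constructor
    · exact fun h => h.1
    · exact fun h => ⟨h, fun k hk hkj => absurd (Fin.ext hkj ▸ hk) hj⟩

theorem rowLen_removeStrip : (removeStrip lam hn s hs).rowLen 0 ≤ n := by
  by_contra! h
  have := YoungDiagram.mem_iff_lt_rowLen.1
    (mem_removeStrip.1 (YoungDiagram.mem_iff_lt_rowLen.2 h)).1
  omega

theorem exists_mem_of_notMem_removeStrip {i j : ℕ} (h : (i, j) ∈ lam)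
    (h' : (i, j) ∉ removeStrip lam hn s hs) :
    ∃ k ∈ s, (k : ℕ) = j ∧ i + 1 = lam.colLen j := by
  simp only [mem_removeStrip, h, true_and, not_forall] at h'
  obtain ⟨k, hk, hkj, hlt⟩ := h'
  have := YoungDiagram.mem_iff_lt_colLen.1 h
  exact ⟨k, hk, hkj, by omega⟩

/-- Rows weakly increase, so a bottom entry `N`, the largest allowed, forces `N` at the bottom of
the next column when that has the same length. -/
theorem isRemovable_markedColumns (N : ℕ) {M : SemistandardYoungTableau lam}
    (hM : M ∈ boundedTableaux lam (N + 1)) : IsRemovable lam (markedColumns n N M) := by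
  rw [mem_boundedTableaux] at hM
  simp only [IsRemovable, mem_markedColumns]
  refine ⟨fun j hj => hj.1, fun j hj k hk hjk => ⟨hjk ▸ hj.1, ?_⟩⟩
  have hc : (lam.colLen k - 1, (k : ℕ)) ∈ lam := YoungDiagram.mem_iff_lt_colLen.2 (by omega)
  have h1 := hM _ _ hc
  have h2 := M.row_weak (j1 := j) (j2 := k) (by omega) hc
  rw [hjk] at h1 h2 ⊢
  omega

/-- The restriction of a tableau to a smaller shape. -/
def restrictTableau {mu : YoungDiagram} (h : mu ≤ lam) (M : SemistandardYoungTableau lam) :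
    SemistandardYoungTableau mu where
  entry i j := if (i, j) ∈ mu then M i j else 0
  row_weak' hj hc := by
    rw [if_pos hc, if_pos (mu.up_left_mem le_rfl hj.le hc)]
    exact M.row_weak hj (h hc)
  col_strict' hi hc := by
    rw [if_pos hc, if_pos (mu.up_left_mem hi.le le_rfl hc)]
    exact M.col_strict hi (h hc)
  zeros' hc := if_neg hc

/-- The extension of a tableau with entries less than `N` by entries `N` in a horizontal strip. -/
def extendTableau (N : ℕ) (M : SemistandardYoungTableau (removeStrip lam hn s hs))
    (hM : M ∈ boundedTableaux _ N) : SemistandardYoungTableau lam where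
  entry i j := if (i, j) ∈ removeStrip lam hn s hs then M i j else if (i, j) ∈ lam then N else 0
  row_weak' {i j1 j2} hj hc := by
    rw [mem_boundedTableaux] at hM
    by_cases h2 : (i, j2) ∈ removeStrip lam hn s hs
    · rw [if_pos h2, if_pos (YoungDiagram.up_left_mem _ le_rfl hj.le h2)]
      exact M.row_weak hj h2
    · rw [if_neg h2, if_pos hc]
      split_ifs with h1
      · exact (hM _ _ h1).le
      · exact le_rfl
      · exact Nat.zero_le _
  col_strict' {i1 i2 j} hi hc := by
    rw [mem_boundedTableaux] at hM
    have h1 : (i1, j) ∈ removeStrip lam hn s hs := mem_removeStrip.2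
      ⟨lam.up_left_mem hi.le le_rfl hc, fun _ _ _ => by
        have := YoungDiagram.mem_iff_lt_colLen.1 hc; omega⟩
    rw [if_pos h1]
    split_ifs with h2
    · exact M.col_strict hi h2
    · exact hM _ _ h1
  zeros' hc := by
    rw [if_neg fun h => hc (removeStrip_le h), if_neg hc]

theorem restrictTableau_apply {mu : YoungDiagram} (h : mu ≤ lam)
    (M : SemistandardYoungTableau lam) (i j : ℕ) :
    restrictTableau h M i j = if (i, j) ∈ mu then M i j else 0 := rfl

theorem extendTableau_apply (N : ℕ) (M : SemistandardYoungTableau (removeStrip lam hn s hs))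
    (hM : M ∈ boundedTableaux _ N) (i j : ℕ) : extendTableau N M hM i j =
      if (i, j) ∈ removeStrip lam hn s hs then M i j else if (i, j) ∈ lam then N else 0 := rfl

/-- Strict columns allow the maximal entry `N` only in the last cell of a column, so deleting the
marked cells deletes every `N`. -/
theorem restrictTableau_mem (N : ℕ) {M : SemistandardYoungTableau lam}
    (hM : M ∈ boundedTableaux lam (N + 1)) (hMs : markedColumns n N M = s) :
    restrictTableau (removeStrip_le (hn := hn) (hs := hs)) M ∈ boundedTableaux _ N := by
  rw [mem_boundedTableaux] at hM ⊢
  intro i j hij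
  rw [restrictTableau_apply, if_pos hij]
  have hc := removeStrip_le hij
  have hl := YoungDiagram.mem_iff_lt_colLen.1 hc
  have hj : j < n := by
    have := YoungDiagram.mem_iff_lt_rowLen.1 (lam.up_left_mem (Nat.zero_le _) le_rfl hc)
    omega
  have hb : (lam.colLen j - 1, j) ∈ lam := YoungDiagram.mem_iff_lt_colLen.2 (by omega)
  have hbN := hM _ _ hb
  by_cases hjs : (⟨j, hj⟩ : Fin n) ∈ s
  · have h2 := (mem_removeStrip.1 hij).2 _ hjs rfl
    have := M.col_strict (i1 := i) (by omega) hb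
    omega
  · have hne : M (lam.colLen j - 1) j ≠ N := fun h => hjs <| by
      rw [← hMs, mem_markedColumns]
      exact ⟨Nat.zero_lt_of_lt hl, h⟩
    have := M.col_weak (i1 := i) (by omega) hb
    omega

theorem extendTableau_mem (N : ℕ) (M : SemistandardYoungTableau (removeStrip lam hn s hs))
    (hM : M ∈ boundedTableaux _ N) : extendTableau N M hM ∈ boundedTableaux lam (N + 1) := by
  rw [mem_boundedTableaux] at ⊢
  intro i j hij
  rw [extendTableau_apply]
  split_ifs with h
  · exact (mem_boundedTableaux.1 hM _ _ h).trans (Nat.lt_succ_self N)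
  · exact Nat.lt_succ_self N

theorem markedColumns_extendTableau (N : ℕ)
    (M : SemistandardYoungTableau (removeStrip lam hn s hs))
    (hM : M ∈ boundedTableaux _ N) : markedColumns n N (extendTableau N M hM) = s := by
  ext j
  rw [mem_markedColumns, extendTableau_apply]
  constructor
  · rintro ⟨h0, h⟩
    have hb : (lam.colLen j - 1, (j : ℕ)) ∈ lam := YoungDiagram.mem_iff_lt_colLen.2 (by omega)
    split_ifs at h with h1
    · have := mem_boundedTableaux.1 hM _ _ h1
      omega
    · obtain ⟨k, hk, hkj, -⟩ := exists_mem_of_notMem_removeStrip hb h1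
      exact Fin.ext hkj ▸ hk
  · intro h
    have h0 := hs.1 j h
    refine ⟨h0, ?_⟩
    rw [if_neg, if_pos (YoungDiagram.mem_iff_lt_colLen.2 (by omega))]
    intro h1
    have := (mem_removeStrip.1 h1).2 j h rfl
    omega

theorem cells_sdiff_removeStrip : lam.cells \ (removeStrip lam hn s hs).cells =
    s.image fun j : Fin n => (lam.colLen j - 1, (j : ℕ)) := by
  ext ⟨i, j⟩
  simp only [Finset.mem_sdiff, YoungDiagram.mem_cells, Finset.mem_image, Prod.mk.injEq]
  constructor
  · rintro ⟨h1, h2⟩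
    obtain ⟨k, hk, rfl, hi⟩ := exists_mem_of_notMem_removeStrip h1 h2
    exact ⟨k, hk, by omega, rfl⟩
  · rintro ⟨k, hk, rfl, rfl⟩
    have h0 := hs.1 k hk
    refine ⟨YoungDiagram.mem_iff_lt_colLen.2 (by omega), fun h => ?_⟩
    have := (mem_removeStrip.1 h).2 k hk rfl
    omega

theorem tableauWeight_extendTableau {R : Type*} [CommRing R] (z : ℤ → ℕ → R) (N : ℕ)
    (M : SemistandardYoungTableau (removeStrip lam hn s hs)) (hM : M ∈ boundedTableaux _ N) :
    tableauWeight z (extendTableau N M hM) =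
      (∏ j ∈ s, z ((j : ℤ) - lam.colLen j + 1) N) * tableauWeight z M := by
  have hsub : (removeStrip lam hn s hs).cells ⊆ lam.cells :=
    YoungDiagram.cells_subset_iff.2 removeStrip_le
  rw [tableauWeight, ← Finset.prod_sdiff hsub, cells_sdiff_removeStrip, Finset.prod_image]
  · congr 1
    · refine Finset.prod_congr rfl fun j hj => ?_
      have h0 := hs.1 j hj
      have h1 : (lam.colLen j - 1, (j : ℕ)) ∉ removeStrip lam hn s hs := fun h => by
        have := (mem_removeStrip.1 h).2 j hj rfl
        omega
      rw [extendTableau_apply, if_neg h1,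
        if_pos (YoungDiagram.mem_iff_lt_colLen.2 (Nat.sub_lt h0 Nat.one_pos)), content]
      congr 1
      push_cast [Nat.cast_sub h0]
      ring
    · refine Finset.prod_congr rfl fun x hx => ?_
      rw [extendTableau_apply, if_pos ((YoungDiagram.mem_cells _).1 hx)]
  · intro j _ k _ h
    exact Fin.ext (Prod.ext_iff.1 h).2

theorem extend_restrict (N : ℕ) {M : SemistandardYoungTableau lam}
    (hM : M ∈ boundedTableaux lam (N + 1)) (hMs : markedColumns n N M = s) :
    extendTableau N _ (restrictTableau_mem (hn := hn) (hs := hs) N hM hMs) = M := by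
  ext i j
  rw [extendTableau_apply, restrictTableau_apply]
  split_ifs with h1 h2
  · rfl
  · obtain ⟨k, hk, rfl, hi⟩ := exists_mem_of_notMem_removeStrip h2 h1
    rw [← hMs, mem_markedColumns] at hk
    obtain rfl : i = lam.colLen k - 1 := by omega
    exact hk.2.symm
  · exact (M.zeros h2).symm

theorem restrict_extend (N : ℕ) (M : SemistandardYoungTableau (removeStrip lam hn s hs))
    (hM : M ∈ boundedTableaux _ N) : restrictTableau removeStrip_le (extendTableau N M hM) = M := by
  ext i j
  rw [restrictTableau_apply, extendTableau_apply]
  split_ifs with h1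
  · rfl
  · exact (M.zeros h1).symm

/-- Restriction and extension by `N` are inverse bijections. The last cell of column `j` is in row
`lam.colLen j - 1`, hence the `+ 1` in its content. -/
theorem sum_markedColumns_eq {R : Type*} [CommRing R] (z : ℤ → ℕ → R) (N : ℕ)
    (hn : lam.rowLen 0 ≤ n) (hs : IsRemovable lam s) :
    ∑ M ∈ boundedTableaux lam (N + 1) with markedColumns n N M = s, tableauWeight z M =
      (∏ j ∈ s, z ((j : ℤ) - lam.colLen j + 1) N) * boundedSum z (removeStrip lam hn s hs) N := by
  rw [boundedSum, Finset.mul_sum]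
  symm
  refine Finset.sum_bij' (fun M hM => extendTableau N M hM)
    (fun M _ => restrictTableau removeStrip_le M) ?_ ?_ ?_ ?_ ?_
  · exact fun M hM => Finset.mem_filter.2
      ⟨extendTableau_mem N M hM, markedColumns_extendTableau N M hM⟩
  · exact fun M hM => restrictTableau_mem N (Finset.mem_filter.1 hM).1 (Finset.mem_filter.1 hM).2
  · exact fun M hM => restrict_extend N M hM
  · exact fun M hM => extend_restrict N (Finset.mem_filter.1 hM).1 (Finset.mem_filter.1 hM).2
  · exact fun M hM => (tableauWeight_extendTableau z N M hM).symm

end Strip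

/-- The branching rule: removing the entries `N` of a tableau. -/
theorem boundedSum_succ {R : Type*} [CommRing R] (z : ℤ → ℕ → R) (N : ℕ) {lam : YoungDiagram}
    {n : ℕ} {F : Finset (Fin n) → R} (hn : lam.rowLen 0 ≤ n)
    (hF : ∀ s (hs : IsRemovable lam s), F s =
      (∏ j ∈ s, z ((j : ℤ) - lam.colLen j + 1) N) * boundedSum z (removeStrip lam hn s hs) N)
    (hF0 : ∀ s : Finset (Fin n), ¬ IsRemovable lam s → F s = 0) :
    boundedSum z lam (N + 1) = ∑ s, F s := by
  rw [boundedSum, ← Finset.sum_fiberwise _ (markedColumns n N)]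
  refine Finset.sum_congr rfl fun s _ => ?_
  by_cases hs : IsRemovable lam s
  · rw [hF s hs, sum_markedColumns_eq z N hn hs]
  · rw [hF0 s hs]
    refine Finset.sum_eq_zero fun M hM => absurd ?_ hs
    rw [← (Finset.mem_filter.1 hM).2]
    exact isRemovable_markedColumns N (Finset.mem_filter.1 hM).1

/-! ### The dual Jacobi–Trudi formula -/

/-- The entries of the dual Jacobi–Trudi matrix: `columnVector z N p i` is the generating function
of the strictly decreasing sequences of `i - p` integers less than `N`, placed on the contents
`p + 1, …, i`. -/
def columnVector {R : Type*} [CommRing R] (z : ℤ → ℕ → R) : ℕ → ℤ → ℤ → R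
  | 0, p, i => if p = i then 1 else 0
  | N + 1, p, i => columnVector z N p i + z (p + 1) N * columnVector z N (p + 1) i

section

variable {R : Type*} [CommRing R] (z : ℤ → ℕ → R)

theorem columnVector_of_lt (N : ℕ) {p i : ℤ} (h : i < p) : columnVector z N p i = 0 := by
  induction N generalizing p with
  | zero => exact if_neg (by omega)
  | succ N ih => rw [columnVector, ih h, ih (h.trans (lt_add_one p)), mul_zero, add_zero]

theorem columnVector_self (N : ℕ) (p : ℤ) : columnVector z N p p = 1 := by
  induction N with
  | zero => exact if_pos rfl
  | succ N ih => rw [columnVector, ih, columnVector_of_lt z N (lt_add_one p), mul_zero, add_zero]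

/-- If closure under the next column of equal length fails, two adjacent rows coincide. Otherwise
`s` contains an empty column and so all columns after it; the last row then has index `n`, beyond
every column index, and vanishes. -/
theorem det_columnVector_eq_zero {n : ℕ} (N : ℕ) {lam : YoungDiagram} {s : Finset (Fin n)}
    (hs : ¬ IsRemovable lam s) :
    (Matrix.of fun j i : Fin n => columnVector z N
      ((j : ℤ) - lam.colLen j + if j ∈ s then 1 else 0) i).det = 0 := by
  by_cases h2 : ∀ j ∈ s, ∀ k : Fin n, (k : ℕ) = j + 1 → lam.colLen k = lam.colLen j → k ∈ s
  · have h1 : ∃ j ∈ s, lam.colLen j = 0 := by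
      by_contra! h
      exact hs ⟨fun j hj => Nat.pos_of_ne_zero (h j hj), h2⟩
    obtain ⟨j, hj, hj0⟩ := h1
    have hlast : ∀ k : ℕ, (j : ℕ) ≤ k → ∀ hk : k < n, ⟨k, hk⟩ ∈ s ∧ lam.colLen k = 0 := by
      intro k hjk
      induction k, hjk using Nat.le_induction with
      | base => exact fun _ => ⟨hj, hj0⟩
      | succ k hjk ih =>
        intro hk
        obtain ⟨h3, h4⟩ := ih (by omega)
        have h5 := lam.colLen_anti k (k + 1) (by omega)
        exact ⟨h2 _ h3 _ rfl (by simp only; omega), by omega⟩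
    have hjn := j.2
    obtain ⟨h3, h4⟩ := hlast (n - 1) (by omega) (by omega)
    refine Matrix.det_eq_zero_of_row_eq_zero ⟨n - 1, by omega⟩ fun i => ?_
    have hi := i.2
    rw [Matrix.of_apply, if_pos h3]
    simp only [h4]
    exact columnVector_of_lt z N (by omega)
  · push Not at h2
    obtain ⟨j, hj, k, hk, hkj, hks⟩ := h2
    refine Matrix.det_zero_of_row_eq (i := j) (j := k) (by rintro rfl; omega) ?_
    funext i
    simp only [Matrix.of_apply, if_pos hj, if_neg hks, hkj]
    congr 1
    push_cast [hk]
    ring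

theorem boundedSum_bot_zero : boundedSum z ⊥ 0 = 1 := by
  have : boundedTableaux (⊥ : YoungDiagram) 0 = {default} := by
    ext M
    simp only [mem_boundedTableaux, Finset.mem_singleton, YoungDiagram.notMem_bot, false_imp_iff,
      implies_true, true_iff]
    ext i j
    rw [M.zeros (YoungDiagram.notMem_bot _),
      SemistandardYoungTableau.zeros _ (YoungDiagram.notMem_bot _)]
  simp [boundedSum, this, tableauWeight]

theorem boundedSum_zero {lam : YoungDiagram} (h : lam ≠ ⊥) : boundedSum z lam 0 = 0 := by
  refine Finset.sum_eq_zero fun M hM => absurd ?_ h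
  rw [mem_boundedTableaux] at hM
  refine le_bot_iff.1 fun x hx => ?_
  exact absurd (hM x.1 x.2 hx) (Nat.not_lt_zero _)

/-- The dual Jacobi–Trudi formula for tableaux with weights depending on contents. -/
theorem boundedSum_eq_det (N : ℕ) {lam : YoungDiagram} {n : ℕ} (hn : lam.rowLen 0 ≤ n) :
    boundedSum z lam N =
      (Matrix.of fun j i : Fin n => columnVector z N ((j : ℤ) - lam.colLen j) i).det := by
  induction N generalizing lam with
  | zero =>
    by_cases h : lam = ⊥
    · subst h
      rw [boundedSum_bot_zero, ← Matrix.det_one (n := Fin n)]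
      congr 1
      ext j i
      have : (⊥ : YoungDiagram).colLen j = 0 := by
        by_contra h
        exact YoungDiagram.notMem_bot (0, (j : ℕ))
          (YoungDiagram.mem_iff_lt_colLen.2 (Nat.pos_of_ne_zero h))
      simp [columnVector, this, Matrix.one_apply, Fin.ext_iff]
    · have h0 : (0, 0) ∈ lam := by
        by_contra h0
        exact h (le_bot_iff.1 fun x hx =>
          absurd (lam.up_left_mem (Nat.zero_le x.1) (Nat.zero_le x.2) hx) h0)
      have h1 := YoungDiagram.mem_iff_lt_rowLen.1 h0
      have h2 := YoungDiagram.mem_iff_lt_colLen.1 h0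
      rw [boundedSum_zero z h]
      symm
      -- The first row has the negative index `-lam.colLen 0`, which equals no `i`.
      refine Matrix.det_eq_zero_of_row_eq_zero ⟨0, by omega⟩ fun i => ?_
      simp only [Matrix.of_apply, columnVector]
      exact if_neg (by omega)
  | succ N ih =>
    let m : Fin n → Fin n → R := fun j i => columnVector z N ((j : ℤ) - lam.colLen j) i
    let m' : Fin n → Fin n → R := fun j i => columnVector z N ((j : ℤ) - lam.colLen j + 1) i
    let c : Fin n → R := fun j => z ((j : ℤ) - lam.colLen j + 1) N
    have hdet : (Matrix.of fun j i : Fin n =>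
        columnVector z (N + 1) ((j : ℤ) - lam.colLen j) i).det =
        ∑ s : Finset (Fin n), (∏ j ∈ s, c j) * (Matrix.of fun j i : Fin n => columnVector z N
          ((j : ℤ) - lam.colLen j + if j ∈ s then 1 else 0) i).det := by
      -- Each row is a sum of two by the recursion for `columnVector`; `s` records the rows where
      -- the shifted summand is chosen.
      have h1 := (Matrix.detRowAlternating (n := Fin n) (R := R)).toMultilinearMap.map_add_univ
        (fun j => c j • m' j) m
      refine Eq.trans ?_ (h1.trans (Finset.sum_congr rfl fun s _ => ?_))
      · change Matrix.det _ = Matrix.det _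
        congr 1
        ext j i
        simp [columnVector, m, m', c, add_comm]
      · have h2 := (Matrix.detRowAlternating (n := Fin n) (R := R)).toMultilinearMap.map_piecewise_smul
          c (s.piecewise m' m) s
        have h3 : s.piecewise (fun j => c j • s.piecewise m' m j) (s.piecewise m' m) =
            s.piecewise (fun j => c j • m' j) m := by
          ext j i
          by_cases hj : j ∈ s <;> simp [hj]
        rw [h3] at h2
        rw [h2, smul_eq_mul]
        congr 1
        change Matrix.det _ = Matrix.det _
        congr 1
        ext j i
        by_cases hj : j ∈ s <;> simp [hj, m, m']
    rw [hdet]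
    refine boundedSum_succ z N hn (fun s hs => ?_) fun s hs => ?_
    · rw [ih rowLen_removeStrip]
      congr 2
      ext j i
      simp only [Matrix.of_apply, colLen_removeStrip]
      congr 1
      split_ifs with hj
      · have := hs.1 j hj
        push_cast [Nat.cast_sub this]
        ring
      · simp
    · rw [det_columnVector_eq_zero z N hs, mul_zero]

end

/-! ### Normalisation of the Jacobi–Trudi matrix -/

/-- Rows are multiplied by the inverse of the unitriangular matrix `P`. That `w` does not depend on
`f` allows the same `w` for a shape and its hooks. -/
theorem exists_normalized_columnVector {R : Type*} [CommRing R] (z : ℤ → ℕ → R) (N n : ℕ) :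
    ∃ w : ℤ → ℕ → R, (∀ k i : ℕ, k < n → i < n → w k i = if k = i then 1 else 0) ∧
      ∀ f : Fin n → ℤ, (Matrix.of fun j i : Fin n => columnVector z N (f j) i).det =
        (Matrix.of fun j i : Fin n => w (f j) i).det := by
  classical
  set P : Matrix (Fin n) (Fin n) R := Matrix.of fun j i => columnVector z N (j : ℤ) i with hP
  have hdet : P.det = 1 := by
    rw [Matrix.det_of_isUpperTriangular]
    · exact Finset.prod_eq_one fun j _ => columnVector_self z N _
    · intro j i hij
      exact columnVector_of_lt z N (by exact_mod_cast hij)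
  have hunit : IsUnit P.det := hdet ▸ isUnit_one
  refine ⟨fun p i => if h : i < n then
    Matrix.vecMul (fun k : Fin n => columnVector z N p k) P⁻¹ ⟨i, h⟩ else 0, ?_, ?_⟩
  · intro k i hk hi
    refine (dif_pos hi).trans ?_
    have : (P * P⁻¹) ⟨k, hk⟩ ⟨i, hi⟩ = if k = i then 1 else 0 := by
      rw [Matrix.mul_nonsing_inv P hunit, Matrix.one_apply]
      simp
    exact this
  · intro f
    have hmul : (Matrix.of fun j i : Fin n => if h : (i : ℕ) < n then
        Matrix.vecMul (fun k : Fin n => columnVector z N (f j) k) P⁻¹ ⟨i, h⟩ else 0) =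
        (Matrix.of fun j i : Fin n => columnVector z N (f j) i) * P⁻¹ := by
      ext j i
      simp only [Matrix.of_apply, dif_pos i.2]
      rfl
    have hinv := congrArg Matrix.det (Matrix.mul_nonsing_inv P hunit)
    rw [Matrix.det_mul, hdet, one_mul, Matrix.det_one] at hinv
    rw [hmul, Matrix.det_mul, hinv, mul_one]

/-! ### The permutation attached to the Frobenius notation -/

theorem diagLen_le_rowLen (lam : YoungDiagram) : diagLen lam ≤ lam.rowLen 0 := by
  by_contra! h
  have := YoungDiagram.mem_iff_lt_rowLen.1
    (lam.up_left_mem (Nat.zero_le _) le_rfl (lt_diagLen_iff.1 h))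
  omega

theorem colLen_le_of_diagLen_le {lam : YoungDiagram} {j : ℕ} (h : diagLen lam ≤ j) :
    lam.colLen j ≤ j := by
  by_contra! hj
  have := lt_diagLen_iff.2 (YoungDiagram.mem_iff_lt_colLen.2 hj)
  omega

/-- The arm lengths of the diagonal cells, followed by the numbers `j - lam'_j` for the columns
without diagonal cell. -/
def frobeniusPos (lam : YoungDiagram) (j : ℕ) : ℕ :=
  if j < diagLen lam then arm lam j else j - lam.colLen j

section

variable {lam : YoungDiagram}

theorem frobeniusPos_lt {n j : ℕ} (hn : lam.rowLen 0 ≤ n) (hj : j < n) :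
    frobeniusPos lam j < n := by
  rw [frobeniusPos]
  split_ifs with h
  · have := arm_add h
    have := lam.rowLen_anti 0 j (Nat.zero_le _)
    omega
  · omega

theorem frobeniusPos_lt_of_lt_of_lt {i j : ℕ} (hij : i < j) (hj : j < diagLen lam) :
    frobeniusPos lam j < frobeniusPos lam i := by
  rw [frobeniusPos, frobeniusPos, if_pos hj, if_pos (hij.trans hj)]
  have := arm_add hj
  have := arm_add (hij.trans hj)
  have := lam.rowLen_anti i j hij.le
  omega

theorem frobeniusPos_lt_of_le_of_lt {i j : ℕ} (hi : diagLen lam ≤ i) (hij : i < j) :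
    frobeniusPos lam i < frobeniusPos lam j := by
  rw [frobeniusPos, frobeniusPos, if_neg hi.not_gt, if_neg (hi.trans hij.le).not_gt]
  have := colLen_le_of_diagLen_le hi
  have := lam.colLen_anti i j hij.le
  omega

/-- Equality would mean `lam.rowLen i + lam.colLen j = i + j + 1`, but this sum is at least `i + j +
2` if `(i, j)` is a cell and at most `i + j` otherwise. -/
theorem frobeniusPos_ne {i j : ℕ} (hi : i < diagLen lam) (hj : diagLen lam ≤ j) :
    frobeniusPos lam i ≠ frobeniusPos lam j := by
  rw [frobeniusPos, frobeniusPos, if_pos hi, if_neg hj.not_gt]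
  have h1 := arm_add hi
  have h2 := colLen_le_of_diagLen_le hj
  by_cases h : (i, j) ∈ lam
  · have h3 := YoungDiagram.mem_iff_lt_colLen.1 h
    have h4 := YoungDiagram.mem_iff_lt_rowLen.1 h
    omega
  · have h3 := mt YoungDiagram.mem_iff_lt_colLen.2 h
    have h4 := mt YoungDiagram.mem_iff_lt_rowLen.2 h
    omega

theorem frobeniusPos_injective (lam : YoungDiagram) : Function.Injective (frobeniusPos lam) := by
  have key : ∀ i j, i < j → frobeniusPos lam i ≠ frobeniusPos lam j := by
    intro i j hij
    by_cases hi : i < diagLen lam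
    · by_cases hj : j < diagLen lam
      · exact (frobeniusPos_lt_of_lt_of_lt hij hj).ne'
      · exact frobeniusPos_ne hi (not_lt.1 hj)
    · exact (frobeniusPos_lt_of_le_of_lt (not_lt.1 hi) hij).ne
  intro i j h
  rcases lt_trichotomy i j with hij | hij | hij
  · exact absurd h (key i j hij)
  · exact hij
  · exact absurd h.symm (key j i hij)

/-- `frobeniusPos` as a permutation of the first `n` natural numbers. -/
noncomputable def frobeniusPerm {n : ℕ} (hn : lam.rowLen 0 ≤ n) : Equiv.Perm (Fin n) :=
  Equiv.ofBijective (fun j => ⟨frobeniusPos lam j, frobeniusPos_lt hn j.2⟩)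
    (Finite.injective_iff_bijective.1 fun _ _ h =>
      Fin.ext (frobeniusPos_injective lam (Fin.ext_iff.1 h)))

theorem frobeniusPerm_val {n : ℕ} (hn : lam.rowLen 0 ≤ n) (j : Fin n) :
    (frobeniusPerm hn j : ℕ) = frobeniusPos lam j := rfl

/-- The permutation decreases on positions below `diagLen lam` and increases afterwards. So for `i <
diagLen lam` all `arm lam i` smaller values occur after `i`, and later positions start no inversion.
-/
theorem sign_frobeniusPerm {n : ℕ} (hn : lam.rowLen 0 ≤ n) :
    (frobeniusPerm hn).sign = ∏ i : Fin (diagLen lam), (-1 : ℤˣ) ^ arm lam i := by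
  have hi : ∀ i : Fin n, ∏ j ∈ Finset.Ioi i,
      (if frobeniusPerm hn i < frobeniusPerm hn j then (1 : ℤˣ) else -1) =
        if (i : ℕ) < diagLen lam then (-1) ^ arm lam i else 1 := by
    intro i
    split_ifs with h
    · have h1 : ∀ j, (if frobeniusPerm hn i < frobeniusPerm hn j then (1 : ℤˣ) else -1) =
          if ¬ frobeniusPerm hn i < frobeniusPerm hn j then -1 else 1 := fun j => by
        split_ifs <;> rfl
      simp_rw [h1]
      rw [← Finset.prod_filter, Finset.prod_const]
      congr 1
      have h2 : (Finset.Ioi i).filter (fun j => ¬ frobeniusPerm hn i < frobeniusPerm hn j) =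
          (Finset.Iio (frobeniusPerm hn i)).map (frobeniusPerm hn).symm.toEmbedding := by
        ext j
        rw [Finset.mem_map_equiv, Finset.mem_filter, Finset.mem_Ioi, Finset.mem_Iio,
          Equiv.symm_symm, not_lt]
        constructor
        · exact fun hj => hj.2.lt_of_ne fun he => hj.1.ne' ((frobeniusPerm hn).injective he)
        · refine fun hj => ⟨?_, hj.le⟩
          by_contra! hji
          rcases hji.eq_or_lt with rfl | hji
          · exact lt_irrefl _ hj
          · exact lt_asymm hj (frobeniusPos_lt_of_lt_of_lt (lam := lam) hji h)
      rw [h2, Finset.card_map, Fin.card_Iio, frobeniusPerm_val, frobeniusPos, if_pos h]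
    · refine Finset.prod_eq_one fun j hj => if_pos ?_
      exact frobeniusPos_lt_of_le_of_lt (lam := lam) (not_lt.1 h)
        (Fin.lt_def.1 (Finset.mem_Ioi.1 hj))
  rw [Equiv.Perm.sign_eq_prod_prod_Ioi, Finset.prod_congr rfl fun i _ => hi i,
    Fin.prod_univ_eq_prod_range (fun i => if i < diagLen lam then (-1 : ℤˣ) ^ arm lam i else 1) n,
    Fin.prod_univ_eq_prod_range (fun i => (-1 : ℤˣ) ^ arm lam i) (diagLen lam),
    ← Finset.prod_filter]
  refine Finset.prod_congr ?_ fun _ _ => rfl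
  have := diagLen_le_rowLen lam
  ext i
  simp only [Finset.mem_filter, Finset.mem_range]
  omega

end

/-- A determinant whose rows are unit vectors except for those belonging to columns of `lam` with
a diagonal cell reduces to a determinant in Frobenius coordinates. -/
theorem det_eq_det_frobenius {R : Type*} [CommRing R] {lam : YoungDiagram} {n t : ℕ}
    (ht : diagLen lam = t) (hn : lam.rowLen 0 ≤ n) {w : ℤ → ℕ → R}
    (hw : ∀ k i : ℕ, k < n → i < n → w k i = if k = i then 1 else 0) :
    (Matrix.of fun j i : Fin n => w ((j : ℤ) - lam.colLen j) i).det =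
      (Matrix.of fun i j : Fin t =>
        (-1) ^ arm lam i * w (-(leg lam j : ℤ) - 1) (arm lam i)).det := by
  subst ht
  set A : Matrix (Fin n) (Fin n) R := Matrix.of fun j i => w ((j : ℤ) - lam.colLen j) i
  -- Permuting by `frobeniusPerm` puts the 1 of each unit vector on the diagonal, which makes `M`
  -- block triangular with an identity block.
  set M : Matrix (Fin n) (Fin n) R := A.transpose.submatrix (frobeniusPerm hn) id
  have hM : ∀ i j, M i j = w ((j : ℤ) - lam.colLen j) (frobeniusPos lam i) := fun _ _ => rfl
  have hM1 : ∀ i j : Fin n, ¬ (j : ℕ) < diagLen lam → M i j = if i = j then 1 else 0 := by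
    intro i j hj
    have h1 : (j : ℤ) - lam.colLen j = (frobeniusPos lam j : ℕ) := by
      have := colLen_le_of_diagLen_le (not_lt.1 hj)
      rw [frobeniusPos, if_neg hj]
      omega
    rw [hM, h1, hw _ _ (frobeniusPos_lt hn j.2) (frobeniusPos_lt hn i.2)]
    simp only [(frobeniusPos_injective lam).eq_iff, Fin.ext_iff, eq_comm]
  have hdet : M.det = (Matrix.of fun i j : Fin (diagLen lam) =>
      w (-(leg lam j : ℤ) - 1) (arm lam i)).det := by
    rw [Matrix.twoBlockTriangular_det' M (fun i => (i : ℕ) < diagLen lam)]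
    · have h2 : M.toSquareBlockProp (fun i => ¬ (i : ℕ) < diagLen lam) = 1 := by
        ext i j
        rw [Matrix.toSquareBlockProp_def, Matrix.of_apply, hM1 _ _ j.2, Matrix.one_apply]
        simp only [Subtype.ext_iff]
      rw [h2, Matrix.det_one, mul_one, ← Matrix.det_submatrix_equiv_self
        (Fin.castLEOrderIso ((diagLen_le_rowLen lam).trans hn)).toEquiv]
      congr 1
      ext i j
      rw [Matrix.submatrix_apply, Matrix.toSquareBlockProp_def, Matrix.of_apply, Matrix.of_apply,
        hM]
      have h3 := leg_add j.2
      change w ((j : ℕ) - lam.colLen j) (frobeniusPos lam i) = _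
      rw [frobeniusPos, if_pos i.2]
      congr 1
      omega
    · intro i hi j hj
      rw [hM1 i j hj, if_neg]
      rintro rfl
      exact hj hi
  have hsign : M.det = ((frobeniusPerm hn).sign : R) * A.det := by
    rw [Matrix.det_permute, Matrix.det_transpose]
  have hsq : ((frobeniusPerm hn).sign : R) * ((frobeniusPerm hn).sign : R) = 1 := by
    rw [← Int.cast_mul, ← Units.val_mul, Int.units_mul_self, Units.val_one, Int.cast_one]
  have h4 := Matrix.det_mul_column (fun i : Fin (diagLen lam) => (-1 : R) ^ arm lam i)
    (Matrix.of fun i j : Fin (diagLen lam) => w (-(leg lam j : ℤ) - 1) (arm lam i))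
  refine Eq.trans ?_ h4.symm
  rw [← hdet, hsign]
  have h5 : ∏ i : Fin (diagLen lam), (-1 : R) ^ arm lam i = ((frobeniusPerm hn).sign : R) := by
    rw [sign_frobeniusPerm]
    push_cast
    rfl
  rw [h5, ← mul_assoc, hsq, one_mul]

/-! ### Hooks and the Giambelli formula for bounded entries -/

theorem rowLen_hook (a b : ℕ) : (hook a b).rowLen 0 = a + 1 := by
  refine eq_of_forall_lt_iff fun j => ?_
  rw [← YoungDiagram.mem_iff_lt_rowLen, mem_hook]
  omega

theorem colLen_hook (a b : ℕ) : (hook a b).colLen 0 = b + 1 := by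
  refine eq_of_forall_lt_iff fun i => ?_
  rw [← YoungDiagram.mem_iff_lt_colLen, mem_hook]
  omega

theorem diagLen_hook (a b : ℕ) : diagLen (hook a b) = 1 := by
  refine eq_of_forall_lt_iff fun i => ?_
  rw [lt_diagLen_iff, mem_hook]
  omega

/-- Each hook is no wider than `lam`, so the same size and the same `w` apply to it; its determinant
is 1 by 1 and equals the corresponding entry for `lam`, sign included. -/
theorem boundedSum_giambelli {R : Type*} [CommRing R] (z : ℤ → ℕ → R) (lam : YoungDiagram)
    (N : ℕ) : boundedSum z lam N = (Matrix.of fun i j : Fin (diagLen lam) =>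
      boundedSum z (hook (arm lam i) (leg lam j)) N).det := by
  obtain ⟨w, hw, hdet⟩ := exists_normalized_columnVector z N (lam.rowLen 0)
  rw [boundedSum_eq_det z N le_rfl, hdet, det_eq_det_frobenius rfl le_rfl hw]
  congr 1
  ext i j
  have hrow : (hook (arm lam i) (leg lam j)).rowLen 0 ≤ lam.rowLen 0 := by
    rw [rowLen_hook]
    have := arm_add i.2
    have := lam.rowLen_anti 0 i (Nat.zero_le _)
    omega
  simp only [Matrix.of_apply]
  rw [boundedSum_eq_det z N hrow, hdet,
    det_eq_det_frobenius (diagLen_hook _ _) hrow hw, Matrix.det_fin_one]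
  simp [arm, leg, rowLen_hook, colLen_hook]

/-! ### The limit of unbounded entries -/

theorem tendsto_boundedTableaux (lam : YoungDiagram) :
    Filter.Tendsto (boundedTableaux lam) Filter.atTop Filter.atTop := by
  refine Filter.tendsto_atTop_finset_of_monotone ?_ fun M => ?_
  · intro N N' h M hM
    rw [mem_boundedTableaux] at hM ⊢
    exact fun i j hij => (hM i j hij).trans_le h
  · refine ⟨(lam.cells.sup fun x => M x.1 x.2) + 1, ?_⟩
    rw [mem_boundedTableaux]
    intro i j hij
    exact Nat.lt_succ_of_le
      (Finset.le_sup (f := fun x : ℕ × ℕ => M x.1 x.2) ((YoungDiagram.mem_cells _).2 hij))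

open scoped MvPowerSeries.WithPiTopology in
-- Diagonal constancy enters here: the exponent of a cell depends only on its content.
theorem tendsto_boundedSum_schur {lam : YoungDiagram} {γ : Tableau lam ℕ+} {c : ℤ → ℕ+}
    (hc : ∀ x : lam.cells, γ x = c (content x)) :
    Filter.Tendsto (boundedSum (fun k m => (MvPowerSeries.X m : MvPowerSeries ℕ ℤ) ^ (c k : ℕ)) lam)
      Filter.atTop (nhds (schur lam γ)) := by
  have h : ∀ M : SemistandardYoungTableau lam, tableauMonomial γ M = tableauWeight
      (fun k m => (MvPowerSeries.X m : MvPowerSeries ℕ ℤ) ^ (c k : ℕ)) M := by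
    intro M
    simp only [tableauMonomial, hc]
    exact Finset.prod_coe_sort lam.cells
      fun x => (MvPowerSeries.X (M x.1 x.2) : MvPowerSeries ℕ ℤ) ^ (c (content x) : ℕ)
  have hs := hasSum_schur lam γ
  simp_rw [h] at hs
  rw [HasSum, SummationFilter.unconditional_filter] at hs
  exact hs.comp (tendsto_boundedTableaux lam)

open scoped MvPowerSeries.WithPiTopology in
theorem schur_giambelli {lam : YoungDiagram} {γ : Tableau lam ℕ+} {c : ℤ → ℕ+}
    (hc : ∀ x : lam.cells, γ x = c (content x)) :
    schur lam γ = (Matrix.of fun i j : Fin (diagLen lam) =>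
      schur (hook (arm lam i) (leg lam j)) (hookTableau c (arm lam i) (leg lam j))).det := by
  refine tendsto_nhds_unique (tendsto_boundedSum_schur hc) ?_
  rw [show boundedSum _ lam = _ from funext fun N => boundedSum_giambelli _ lam N]
  refine ((continuous_id.matrix_det).tendsto _).comp ?_
  refine tendsto_pi_nhds.2 fun i => tendsto_pi_nhds.2 fun j => ?_
  exact tendsto_boundedSum_schur fun _ => rfl

/-! ### Quasi-symmetry -/

/-- The exponent vector of `tableauMonomial γ M`. -/
noncomputable def tableauExponent {lam : YoungDiagram} (γ : Tableau lam ℕ+)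
    (M : SemistandardYoungTableau lam) : ℕ →₀ ℕ :=
  ∑ x : lam.cells, Finsupp.single (M x.1.1 x.1.2) (γ x : ℕ)

open scoped MvPowerSeries.WithPiTopology in
-- This turns quasi-symmetry into an equality of cardinalities.
theorem coeff_schur {lam : YoungDiagram} (γ : Tableau lam ℕ+) (d : ℕ →₀ ℕ) :
    MvPowerSeries.coeff d (schur lam γ) =
      ({M : SemistandardYoungTableau lam | d = tableauExponent γ M}.ncard : ℤ) := by
  have h := MvPowerSeries.WithPiTopology.hasSum_iff_hasSum_coeff.1 (hasSum_schur lam γ) d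
  have hfin : {M : SemistandardYoungTableau lam | d = tableauExponent γ M}.Finite :=
    finite_weight γ d
  have h1 : ∀ M : SemistandardYoungTableau lam, MvPowerSeries.coeff d (tableauMonomial γ M) =
      if d = tableauExponent γ M then 1 else 0 := fun M => by
    rw [tableauMonomial_eq, MvPowerSeries.coeff_monomial]
    rfl
  simp_rw [h1] at h
  refine h.unique ?_
  rw [Set.ncard_eq_toFinset_card _ hfin]
  have h2 := hasSum_sum_of_ne_finset_zero (L := .unconditional _) (s := hfin.toFinset)
    (f := fun M => if d = tableauExponent γ M then (1 : ℤ) else 0) fun M hM =>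
      if_neg fun hd => hM (hfin.mem_toFinset.2 hd)
  have h3 : ∑ M ∈ hfin.toFinset, (if d = tableauExponent γ M then (1 : ℤ) else 0) =
      hfin.toFinset.card := by
    have hmem : ∀ M ∈ hfin.toFinset, d = tableauExponent γ M := fun M hM =>
      hfin.mem_toFinset.1 hM
    rw [Finset.sum_congr rfl fun M hM => if_pos (hmem M hM), Finset.sum_const, nsmul_one]
  rwa [h3] at h2

/-- Relabelling of the entries of a tableau. -/
def relabel {lam : YoungDiagram} (f : ℕ → ℕ) (M : SemistandardYoungTableau lam)
    (hf : StrictMonoOn f {m | ∃ x ∈ lam, M x.1 x.2 = m}) : SemistandardYoungTableau lam where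
  entry i j := if (i, j) ∈ lam then f (M i j) else 0
  row_weak' {i j1 j2} hj hc := by
    have hc' := lam.up_left_mem le_rfl hj.le hc
    rw [if_pos hc, if_pos hc']
    exact hf.monotoneOn ⟨_, hc', rfl⟩ ⟨_, hc, rfl⟩ (M.row_weak hj hc)
  col_strict' {i1 i2 j} hi hc := by
    have hc' := lam.up_left_mem hi.le le_rfl hc
    rw [if_pos hc, if_pos hc']
    exact hf ⟨_, hc', rfl⟩ ⟨_, hc, rfl⟩ (M.col_strict hi hc)
  zeros' hc := if_neg hc

theorem relabel_apply {lam : YoungDiagram} (f : ℕ → ℕ) (M : SemistandardYoungTableau lam)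
    (hf : StrictMonoOn f {m | ∃ x ∈ lam, M x.1 x.2 = m}) {i j : ℕ} (h : (i, j) ∈ lam) :
    relabel f M hf i j = f (M i j) := if_pos h

theorem tableauExponent_relabel {lam : YoungDiagram} (γ : Tableau lam ℕ+) (f : ℕ → ℕ)
    (M : SemistandardYoungTableau lam) (hf : StrictMonoOn f {m | ∃ x ∈ lam, M x.1 x.2 = m}) :
    tableauExponent γ (relabel f M hf) = (tableauExponent γ M).mapDomain f := by
  rw [tableauExponent, tableauExponent, Finsupp.mapDomain_finsetSum]
  refine Finset.sum_congr rfl fun x _ => ?_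
  rw [Finsupp.mapDomain_single, relabel_apply _ _ _ ((YoungDiagram.mem_cells _).1 x.2)]

theorem mem_support_tableauExponent {lam : YoungDiagram} (γ : Tableau lam ℕ+)
    (M : SemistandardYoungTableau lam) {x : ℕ × ℕ} (hx : x ∈ lam) :
    M x.1 x.2 ∈ (tableauExponent γ M).support := by
  rw [Finsupp.mem_support_iff, tableauExponent, Finsupp.finsetSum_apply]
  intro h0
  have := Finset.sum_eq_zero_iff.1 h0 ⟨x, (YoungDiagram.mem_cells _).2 hx⟩ (Finset.mem_univ _)
  simp at this

/-- Replacing each entry `k i` by `h i` is an injection between the two sets; exchanging `k` and `h`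
gives the reverse inequality. -/
theorem ncard_tableauExponent_le {lam : YoungDiagram} (γ : Tableau lam ℕ+) {n : ℕ}
    (g : Fin n → ℕ+) {k h : Fin n → ℕ} (hk : StrictMono k) (hh : StrictMono h) :
    {M : SemistandardYoungTableau lam |
      ∑ i, Finsupp.single (k i) (g i : ℕ) = tableauExponent γ M}.ncard ≤
    {M : SemistandardYoungTableau lam |
      ∑ i, Finsupp.single (h i) (g i : ℕ) = tableauExponent γ M}.ncard := by
  -- The values off the range of `k` are irrelevant: exponents of `γ` are positive, so every entry
  -- of a counted tableau lies in that range.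
  set f : ℕ → ℕ := Function.extend k h id
  have hfk : ∀ i, f (k i) = h i := fun i => hk.injective.extend_apply h id i
  have hmono : StrictMonoOn f (Set.range k) := by
    rintro _ ⟨i, rfl⟩ _ ⟨j, rfl⟩ hij
    rw [hfk, hfk]
    exact hh (hk.lt_iff_lt.1 hij)
  have hrange : ∀ M : SemistandardYoungTableau lam,
      ∑ i, Finsupp.single (k i) (g i : ℕ) = tableauExponent γ M →
      ∀ x ∈ lam, M x.1 x.2 ∈ Set.range k := by
    intro M hM x hx
    have h1 := mem_support_tableauExponent γ M hx
    rw [← hM, Finsupp.mem_support_iff, Finsupp.finsetSum_apply] at h1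
    obtain ⟨i, -, hi⟩ := Finset.exists_ne_zero_of_sum_ne_zero h1
    exact ⟨i, by by_contra hne; exact hi (Finsupp.single_eq_of_ne (Ne.symm hne))⟩
  have hf : ∀ M : SemistandardYoungTableau lam,
      ∑ i, Finsupp.single (k i) (g i : ℕ) = tableauExponent γ M →
      StrictMonoOn f {m | ∃ x ∈ lam, M x.1 x.2 = m} := fun M hM =>
    hmono.mono <| by
      rintro _ ⟨x, hx, rfl⟩
      exact hrange M hM x hx
  rw [← Nat.card_coe_set_eq, ← Nat.card_coe_set_eq]
  have : Finite {M : SemistandardYoungTableau lam |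
      ∑ i, Finsupp.single (h i) (g i : ℕ) = tableauExponent γ M} := finite_weight γ _
  refine Nat.card_le_card_of_injective (fun M => ⟨relabel f M.1 (hf M.1 M.2), ?_⟩) ?_
  · change _ = _
    rw [tableauExponent_relabel, ← (show _ = _ from M.2), Finsupp.mapDomain_finsetSum]
    exact Finset.sum_congr rfl fun i _ => by rw [Finsupp.mapDomain_single, hfk]
  · intro M M' hMM
    ext i j
    by_cases hij : (i, j) ∈ lam
    · have h1 := congrArg (fun T => T.1 i j) hMM
      simp only [relabel_apply _ _ _ hij] at h1
      exact hmono.injOn (hrange M.1 M.2 _ hij) (hrange M'.1 M'.2 _ hij) h1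
    · rw [M.1.zeros hij, M'.1.zeros hij]

theorem isQuasiSymmetric_schur (lam : YoungDiagram) (γ : Tableau lam ℕ+) :
    IsQuasiSymmetric (schur lam γ) := by
  constructor
  -- All tableau monomials have this same degree.
  · refine ⟨∑ x, (γ x : ℕ), fun d hd => ?_⟩
    rw [coeff_schur] at hd
    obtain ⟨M, rfl⟩ := Set.nonempty_of_ncard_ne_zero (by exact_mod_cast hd)
    rw [tableauExponent, map_sum]
    simp
  · intro n g k h hk hh
    rw [coeff_schur, coeff_schur]
    exact congrArg _ (le_antisymm (ncard_tableauExponent_le γ g hk hh)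
      (ncard_tableauExponent_le γ g hh hk))

end SchurQSym

theorem mainTheorem6 (lam : YoungDiagram) (γ : SchurQSym.Tableau lam ℕ+)
    (hγ : γ ∈ SchurQSym.diagTableaux lam ℕ+)
    (c : ℤ → ℕ+) (hc : ∀ x : lam.cells, γ x = c (SchurQSym.content x)) :
    SchurQSym.IsQuasiSymmetric (SchurQSym.schur lam γ) ∧
    (∀ i j : Fin (SchurQSym.diagLen lam),
      SchurQSym.IsQuasiSymmetric
        (SchurQSym.schur (SchurQSym.hook (SchurQSym.arm lam i) (SchurQSym.leg lam j))
          (SchurQSym.hookTableau c (SchurQSym.arm lam i) (SchurQSym.leg lam j)))) ∧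
    SchurQSym.schur lam γ =
      Matrix.det (Matrix.of fun i j : Fin (SchurQSym.diagLen lam) =>
        SchurQSym.schur (SchurQSym.hook (SchurQSym.arm lam i) (SchurQSym.leg lam j))
          (SchurQSym.hookTableau c (SchurQSym.arm lam i) (SchurQSym.leg lam j))) :=
  ⟨SchurQSym.isQuasiSymmetric_schur lam γ,
    fun _ _ => SchurQSym.isQuasiSymmetric_schur _ _, SchurQSym.schur_giambelli hc⟩
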